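/- **Model.** During its transmission time $S$ a UHF-RFID tag sends a signal that is received, in complex baseband, as $r(t)=s_{t_0}(t;\nu,u)+n(t)$ with $s_{t_0}(t;\nu,u)=a(t;u)\,e^{j2\pi\nu(t-t_0)}$, where $\nu\in\mathbb R$ is the Doppler shift, $t_0\in\mathbb R$ a reference time, $u$ the (random) transmitted data, and $n$ complex white Gaussian noise of one-sided power spectral density $N_0>0$ (so its coordinates with respect to an orthonormal family in $L^2(\mathbb R;\mathbb C)$ are independent circular complex Gaussian with $E|n_k|^2=N_0$). Let $P_S>0$ be the average received power. The amplitude $a$ vanishes outside $S$. For PSK, $a(t;u)=\sqrt{P_S}$ in the "zero state" and $-\sqrt{P_S}$ in the "one state" for $t\in S$, with an arbitrary (jointly measurable) random sequence of states. For ASK, each part of $S$ consists of consecutive symbols of equal length, with $a=\sqrt{2P_S}$ in the first half and $a=0$ in the second half of each symbol. The modified Cramér–Rao bound is $\mathrm{MCRB}(\nu)=1/E_{r,u}\big[(\partial_\nu\ln p(r\mid u,\nu))^2\big]$, where the expectation for the continuous-time observation is the supremum of the expectations over all finite vectors of orthonormal coordinates of $r$. It depends on $t_0$; $\sigma^2_{\mathrm{MCRB}}$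 denotes its value for the reference time $t_0$ that minimizes $E_{r,u}\big[(\partial_\nu\ln p(r\mid u,\nu))^2\big]$, i.e. its maximum over $t_0$ (which is attained). For lengths $T_0,T_1,T_2>0$ and a pause $T_{pause}\ge 0$ put $$\sigma^2(C_T)=\frac{3}{2\pi^2C_T}\,\frac{N_0}{P_S},\qquad C_T=T_0^3\ \text{ (one part)},\qquad C_T=(T_1+T_2)^3+12\,T_1T_2T_{pause}\,\frac{T_1+T_2+T_{pause}}{T_1+T_2}\ \text{ (two parts)}.$$ **Theorem.** For every $\nu$: 1. PSK, one signal part, $S=[0,T_0)$: $\sigma^2_{\mathrm{MCRB}}=\sigma^2(C_T)$ with $C_T=T_0^3$. 2. PSK, two signal parts separated by a pause, $S=[0,T_1)\cup[T_1+T_{pause},\,T_1+T_{pause}+T_2)$: $\sigma^2_{\mathrm{MCRB}}=\sigma^2(C_T)$ with the $C_T$ for two parts. 3. ASK, one part of $L\ge1$ symbols of total length $T_0$: $\sigma^2_{\mathrm{MCRB}}=\sigma^2(T_0^3)\left(1-\frac{3}{4L^2}\right)^{-1}$. In particular, for every $\varepsilon>0$ there is an $L_0$ that depends on $\varepsilon$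 only, such that $|\sigma^2_{\mathrm{MCRB}}-\sigma^2(T_0^3)|\le\varepsilon\,\sigma^2(T_0^3)$ whenever $L\ge L_0$. 4. ASK, two parts of lengths $T_1,T_2$ that consist of $L_1$ and $L_2$ symbols: for every $\varepsilon>0$ there is an $L_0$ that depends on $\varepsilon$ only, such that $|\sigma^2_{\mathrm{MCRB}}-\sigma^2(C_T)|\le\varepsilon\,\sigma^2(C_T)$, with the $C_T$ for two parts, whenever $L_1,L_2\ge L_0$. -/

import Mathlib

open MeasureTheory Set
open scoped ENNReal ComplexConjugate

noncomputable section

/-! ### Statistical model: waveforms in complex white Gaussian noise -/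

/-- Square-integrable complex (baseband) waveforms on the time axis. -/
abbrev Waveform : Type := Lp ℂ 2 (volume : Measure ℝ)

/-- The coordinate of the signal `s` along the waveform `e`, i.e. the correlator output
`∫ conj (e t) * s t dt`. -/
def coordinate (e : Waveform) (s : ℝ → ℂ) : ℂ := ∫ t : ℝ, conj (e t) * s t

/-- Probability density (with respect to Lebesgue measure on `ℂⁿ`) of the received coordinate
vector `r = m + n`, where the coordinates of the noise `n` are independent circularly symmetric
complex Gaussian variables with `E |n_k|² = N0`, that is, variance `N0 / 2` in each real
dimension.  These are the coordinates of complex white Gaussian noise of one-sided power spectral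
density `N0` with respect to an orthonormal family of waveforms. -/
def awgnDensity (N0 : ℝ) {n : ℕ} (m r : Fin n → ℂ) : ℝ :=
  ∏ k, (Real.pi * N0)⁻¹ * Real.exp (-(‖r k - m k‖ ^ 2 / N0))

/-- Likelihood `p(r | u, ν)` of the vector `r` of coordinates of the received waveform along the
family `e`; the noise-free waveform is `s ν u`, where `ν` is the parameter to be estimated and `u`
stands for the nuisance parameters (the transmitted data). -/
def likelihood {Ω : Type*} (N0 : ℝ) (s : ℝ → Ω → ℝ → ℂ) {n : ℕ} (e : Fin n → Waveform)
    (u : Ω) (ν : ℝ) (r : Fin n → ℂ) : ℝ :=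
  awgnDensity N0 (fun k => coordinate (e k) (s ν u)) r

/-- The score `∂ log p(r | u, ν) / ∂ν`. -/
def score {Ω : Type*} (N0 : ℝ) (s : ℝ → Ω → ℝ → ℂ) {n : ℕ} (e : Fin n → Waveform)
    (u : Ω) (ν : ℝ) (r : Fin n → ℂ) : ℝ :=
  deriv (fun ν' => Real.log (likelihood N0 s e u ν' r)) ν

/-- `E_{r,u} [(∂ log p(r | u, ν) / ∂ν)²]`, for the observation of the received waveform through its
coordinates along `e`; the nuisance parameter `u` is distributed according to `Q`. -/
def modifiedInformationAlong {Ω : Type*} [MeasurableSpace Ω] (Q : Measure Ω) (N0 : ℝ)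
    (s : ℝ → Ω → ℝ → ℂ) (ν : ℝ) {n : ℕ} (e : Fin n → Waveform) : ℝ≥0∞ :=
  ∫⁻ u, (∫⁻ r : Fin n → ℂ,
    ENNReal.ofReal (score N0 s e u ν r ^ 2 * likelihood N0 s e u ν r) ∂volume) ∂Q

/-- `E_{r,u} [(∂ log p(r | u, ν) / ∂ν)²]` for the observation of the whole continuous-time
waveform: the supremum over all finite-dimensional orthonormal coordinate representations. -/
def modifiedInformation {Ω : Type*} [MeasurableSpace Ω] (Q : Measure Ω) (N0 : ℝ)
    (s : ℝ → Ω → ℝ → ℂ) (ν : ℝ) : ℝ≥0∞ :=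
  ⨆ (n : ℕ) (e : Fin n → Waveform) (_ : Orthonormal ℂ e), modifiedInformationAlong Q N0 s ν e

/-- The modified Cramér–Rao bound for the estimation of `ν`:
`MCRB(ν) = 1 / E_{r,u} [(∂ log p(r | u, ν) / ∂ν)²]`. -/
def MCRB {Ω : Type*} [MeasurableSpace Ω] (Q : Measure Ω) (N0 : ℝ)
    (s : ℝ → Ω → ℝ → ℂ) (ν : ℝ) : ℝ≥0∞ :=
  (modifiedInformation Q N0 s ν)⁻¹

/-! ### Tag signals -/

/-- Noise-free received tag signal with complex amplitude `a u t`, Doppler shift `ν` and reference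
time `t0`: `a u t * exp (j 2π ν (t - t0))`. -/
def tagSignal {Ω : Type*} (a : Ω → ℝ → ℂ) (t0 : ℝ) (ν : ℝ) (u : Ω) (t : ℝ) : ℂ :=
  a u t * Complex.exp (2 * Real.pi * Complex.I * ν * (t - t0))

/-- `σ2` is the modified Cramér–Rao bound for the Doppler shift `ν` of a tag signal with amplitude
`a`, where the reference time `t0` is the one for which the information is minimal, i.e. for which
the bound is the largest (tightest). -/
def IsDopplerMCRB {Ω : Type*} [MeasurableSpace Ω] (Q : Measure Ω) (N0 : ℝ) (a : Ω → ℝ → ℂ)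
    (ν σ2 : ℝ) : Prop :=
  0 ≤ σ2 ∧ IsGreatest (range fun t0 : ℝ => MCRB Q N0 (tagSignal a t0) ν) (ENNReal.ofReal σ2)

/-- Times of transmission for one signal part of length `T0`. -/
def onePart (T0 : ℝ) : Set ℝ := Ico 0 T0

/-- Times of transmission for two signal parts of lengths `T1` and `T2`, separated by a pause of
length `Tpause`. -/
def twoParts (T1 T2 Tpause : ℝ) : Set ℝ :=
  Ico 0 T1 ∪ Ico (T1 + Tpause) (T1 + Tpause + T2)

open Classical in
/-- PSK amplitude with average power `PS`: during transmission, `√PS` in the zero state and `-√PS`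
in the one state; no signal at the other times.  `x u t = true` means that for the data `u` the tag
is in the one state at time `t`. -/
def pskAmplitude {Ω : Type*} (PS : ℝ) (S : Set ℝ) (x : Ω → ℝ → Bool) (u : Ω) (t : ℝ) : ℂ :=
  if t ∈ S then (if x u t then -(Real.sqrt PS : ℂ) else (Real.sqrt PS : ℂ)) else 0

/-- Times in the reflect (one) state for an ASK signal part that starts at time `b` and consists of
`L` symbols of length `T`: the first half of every symbol. -/
def reflectTimes (b T : ℝ) (L : ℕ) : Set ℝ :=
  ⋃ l ∈ Finset.range L, Ico (b + l * T) (b + l * T + T / 2)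

open Classical in
/-- ASK amplitude with average power `PS`: `√(2 PS)` in the reflect state (times in `R`), and `0` in
the absorb state and outside the transmission.  It involves no random data, so that the nuisance
space has one point. -/
def askAmplitude (PS : ℝ) (R : Set ℝ) (_ : Unit) (t : ℝ) : ℂ :=
  if t ∈ R then (Real.sqrt (2 * PS) : ℂ) else 0

/-! ### The claimed value -/

/-- `3 / (2π² C_T) * N0 / P_S`. -/
def sigmaSqMCRB (N0 PS CT : ℝ) : ℝ := 3 / (2 * Real.pi ^ 2 * CT) * (N0 / PS)

/-- `C_T` for one signal part. -/
def CTone (T0 : ℝ) : ℝ := T0 ^ 3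

/-- `C_T` for two signal parts. -/
def CTtwo (T1 T2 Tpause : ℝ) : ℝ :=
  (T1 + T2) ^ 3 + 12 * T1 * T2 * Tpause * ((T1 + T2 + Tpause) / (T1 + T2))

end

/-! ### Second moments of linear statistics of circular Gaussian vectors -/

/-! Given the data, the coordinates of the received waveform are Gaussian about those of the signal
`s`, so the score is a real linear form in the noise. Its second moment along a family `e` is `2 /
N0` times the sum of the squared moduli of the coordinates of `∂s/∂ν` (`score_eq`,
`lintegral_sq_linear_mul_awgnDensity`). By Bessel and Parseval the supremum over orthonormal
families is `2 / N0 * ‖∂s/∂ν‖²` in L² (`modifiedInformation_tagSignal`).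

Since `|∂s/∂ν| = 2π |t - t0| |a|`, only `|a|²` matters: `ν` and the data drop out, and the
information is `8π² / N0` times the moment of inertia of the energy distribution `|a|²` about `t0`.
It is smallest at the centroid (`isDopplerMCRB_of_secondMoment`), so every case reduces to the
central moment of inertia of a union of intervals.

An interval of length `l` contributes `l³ / 12`, and `parallel_axis` combines two parts. For ASK the
doubled power makes up for the half-length windows. What remains is a correction to the inertia of
each part and a shift of each centroid by a quarter symbol, both relatively small when there are
many symbols (`abs_ask_twoParts_sub_CTtwo_le`). -/

theorem integral_sq_sum_mul_prod {ι α : Type*} [Fintype ι] [DecidableEq ι] [MeasureSpace α]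
    [SigmaFinite (volume : Measure α)] {g : α → ℝ} {l : ι → α → ℝ}
    (hg : Integrable g) (hl : ∀ i, Integrable fun z => l i z * g z)
    (hl2 : ∀ i, Integrable fun z => l i z ^ 2 * g z)
    (hg1 : ∫ z, g z = 1) (hl0 : ∀ i, ∫ z, l i z * g z = 0) :
    Integrable (fun r : ι → α => (∑ i, l i (r i)) ^ 2 * ∏ i, g (r i)) ∧
    ∫ r : ι → α, (∑ i, l i (r i)) ^ 2 * ∏ i, g (r i) = ∑ i, ∫ z, l i z ^ 2 * g z := by
  -- Expanding the square gives terms indexed by `(j, k)`, each a product over the coordinates `i`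
  -- of the factors `F j k i`. Fubini then applies termwise, and the terms with `j ≠ k` vanish
  -- because `l j` has mean zero.
  set F : ι → ι → ι → α → ℝ := fun j k i z =>
    (if i = j then l j z else 1) * (if i = k then l k z else 1) * g z with hF
  have hFint : ∀ j k i, Integrable (F j k i) := by
    intro j k i
    by_cases h1 : i = j
    · subst h1
      by_cases h2 : i = k
      · subst h2
        simpa [hF, sq] using hl2 i
      · simpa [hF, h2] using hl i
    · by_cases h2 : i = k
      · subst h2
        simpa [hF, h1] using hl i
      · simpa [hF, h1, h2] using hg
  have hexp : (fun r : ι → α => (∑ i, l i (r i)) ^ 2 * ∏ i, g (r i)) =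
      fun r => ∑ j, ∑ k, ∏ i, F j k i (r i) := by
    funext r
    rw [sq, Finset.sum_mul_sum]
    simp only [hF, Finset.prod_mul_distrib, Finset.prod_ite_eq', Finset.mem_univ, if_true,
      Finset.sum_mul]
  have hint : ∀ j k, Integrable (fun r : ι → α => ∏ i, F j k i (r i)) :=
    fun j k => Integrable.fintype_prod (fun i => hFint j k i)
  have hval : ∀ j k, ∫ r : ι → α, ∏ i, F j k i (r i) =
      if j = k then ∫ z, l j z ^ 2 * g z else 0 := by
    intro j k
    rw [integral_fintype_prod_volume_eq_prod]
    split_ifs with h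
    · subst h
      rw [Finset.prod_eq_single j]
      · simp [hF, sq]
      · intro i _ hij
        simp [hF, hij, hg1]
      · simp
    · apply Finset.prod_eq_zero (Finset.mem_univ j)
      simp [hF, h, hl0]
  rw [hexp]
  refine ⟨integrable_finsetSum _ fun j _ => integrable_finsetSum _ fun k _ => hint j k, ?_⟩
  rw [integral_finsetSum _ fun j _ => integrable_finsetSum _ fun k _ => hint j k]
  refine Finset.sum_congr rfl fun j _ => ?_
  rw [integral_finsetSum _ fun k _ => hint j k]
  simp [hval]

/-- The density of a centered circular complex Gaussian variable of second moment `N0`. -/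
noncomputable def circularGaussian (N0 : ℝ) (z : ℂ) : ℝ :=
  (Real.pi * N0)⁻¹ * Real.exp (-(‖z‖ ^ 2 / N0))

theorem circularGaussian_nonneg {N0 : ℝ} (h : 0 < N0) (z : ℂ) : 0 ≤ circularGaussian N0 z := by
  unfold circularGaussian; positivity

theorem integral_circularGaussian {N0 : ℝ} (h : 0 < N0) : ∫ z, circularGaussian N0 z = 1 := by
  have := Complex.integral_exp_neg_mul_rpow (p := 2) (b := N0⁻¹) (by norm_num) (by positivity)
  unfold circularGaussian
  rw [integral_const_mul]
  have h2 : ∀ z : ℂ, Real.exp (-(‖z‖ ^ 2 / N0)) = Real.exp (-N0⁻¹ * ‖z‖ ^ (2 : ℝ)) := by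
    intro z; rw [Real.rpow_two]; congr 1; ring
  simp_rw [h2, this]
  norm_num [Real.rpow_neg_one]
  field_simp

theorem integral_norm_sq_mul_circularGaussian {N0 : ℝ} (h : 0 < N0) :
    ∫ z, ‖z‖ ^ 2 * circularGaussian N0 z = N0 := by
  have := Complex.integral_rpow_mul_exp_neg_mul_rpow (p := 2) (q := 2) (b := N0⁻¹)
    (by norm_num) (by norm_num) (by positivity)
  unfold circularGaussian
  have h2 : ∀ z : ℂ, ‖z‖ ^ 2 * ((Real.pi * N0)⁻¹ * Real.exp (-(‖z‖ ^ 2 / N0))) =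
      (Real.pi * N0)⁻¹ * (‖z‖ ^ (2 : ℝ) * Real.exp (-N0⁻¹ * ‖z‖ ^ (2 : ℝ))) := by
    intro z; rw [Real.rpow_two, show -(‖z‖ ^ 2 / N0) = -N0⁻¹ * ‖z‖ ^ 2 by ring]; ring
  simp_rw [h2]
  rw [integral_const_mul, this]
  have h3 : (N0⁻¹ : ℝ) ^ (-(2 + 2) / 2 : ℝ) = N0 ^ 2 := by
    rw [show (-(2 + 2) / 2 : ℝ) = -2 by norm_num, Real.rpow_neg (by positivity), Real.rpow_two]
    simp
  rw [h3]
  have h4 : Real.Gamma ((2 + 2) / 2) = 1 := by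
    rw [show ((2 + 2) / 2 : ℝ) = 2 by norm_num, Real.Gamma_two]
  rw [h4]
  field_simp

theorem integrable_circularGaussian {N0 : ℝ} (h : 0 < N0) : Integrable (circularGaussian N0) :=
  integrable_of_integral_eq_one (integral_circularGaussian h)

theorem continuous_circularGaussian (N0 : ℝ) : Continuous (circularGaussian N0) := by
  unfold circularGaussian; fun_prop

theorem integrable_norm_sq_mul_circularGaussian {N0 : ℝ} (h : 0 < N0) :
    Integrable fun z => ‖z‖ ^ 2 * circularGaussian N0 z :=
  Integrable.of_integral_ne_zero (by rw [integral_norm_sq_mul_circularGaussian h]; exact h.ne')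

theorem integrable_sq_linear_mul_circularGaussian {N0 : ℝ} (h : 0 < N0) (d : ℂ) :
    Integrable fun z => (conj d * z).re ^ 2 * circularGaussian N0 z := by
  refine ((integrable_norm_sq_mul_circularGaussian h).const_mul (‖d‖ ^ 2)).mono'
    (by have := continuous_circularGaussian N0; fun_prop) (ae_of_all _ fun z => ?_)
  rw [norm_mul, Real.norm_of_nonneg (sq_nonneg _),
    Real.norm_of_nonneg (circularGaussian_nonneg h z), ← mul_assoc]
  refine mul_le_mul_of_nonneg_right ?_ (circularGaussian_nonneg h z)
  have := Complex.abs_re_le_norm (conj d * z)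
  rw [norm_mul, RCLike.norm_conj] at this
  rw [← mul_pow, ← sq_abs]
  gcongr

theorem integrable_linear_mul_circularGaussian {N0 : ℝ} (h : 0 < N0) (d : ℂ) :
    Integrable fun z => (conj d * z).re * circularGaussian N0 z := by
  refine ((integrable_sq_linear_mul_circularGaussian h d).add
    (integrable_circularGaussian h)).mono'
    (by have := continuous_circularGaussian N0; fun_prop) (ae_of_all _ fun z => ?_)
  rw [norm_mul, Real.norm_of_nonneg (circularGaussian_nonneg h z), Pi.add_apply, ← add_one_mul]
  refine mul_le_mul_of_nonneg_right ?_ (circularGaussian_nonneg h z)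
  rw [Real.norm_eq_abs, ← sq_abs]
  nlinarith [sq_nonneg (|(conj d * z).re| - 1), abs_nonneg (conj d * z).re]

theorem integral_linear_mul_circularGaussian (N0 : ℝ) (d : ℂ) :
    ∫ z, (conj d * z).re * circularGaussian N0 z = 0 := by
  have := integral_neg_eq_self (fun z : ℂ => (conj d * z).re * circularGaussian N0 z) volume
  simp only [circularGaussian, norm_neg, mul_neg, Complex.neg_re, neg_mul, integral_neg] at this ⊢
  linarith

theorem integral_comp_I_mul (f : ℂ → ℝ) : ∫ z, f (Complex.I * z) = ∫ z, f z := by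
  let c : Circle := ⟨Complex.I, mem_sphere_zero_iff_norm.2 Complex.norm_I⟩
  exact (rotation c).measurePreserving.integral_comp
    (rotation c).toHomeomorph.measurableEmbedding f

/-- Multiplying `z` by `I` preserves the density and turns the real part of `conj d * z` into minus
its imaginary part. Both parts therefore have the same second moment, half of `‖d‖² * N0`. -/
theorem integral_sq_linear_mul_circularGaussian {N0 : ℝ} (h : 0 < N0) (d : ℂ) :
    ∫ z, (conj d * z).re ^ 2 * circularGaussian N0 z = ‖d‖ ^ 2 * N0 / 2 := by
  have h1 := integral_comp_I_mul fun z => (conj d * z).re ^ 2 * circularGaussian N0 z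
  have h2 : ∀ z : ℂ, (conj d * (Complex.I * z)).re ^ 2 * circularGaussian N0 (Complex.I * z) =
      ‖d‖ ^ 2 * (‖z‖ ^ 2 * circularGaussian N0 z) - (conj d * z).re ^ 2 * circularGaussian N0 z := by
    intro z
    have e1 : circularGaussian N0 (Complex.I * z) = circularGaussian N0 z := by
      simp [circularGaussian]
    have e2 : (conj d * z).re ^ 2 + (conj d * z).im ^ 2 = ‖d‖ ^ 2 * ‖z‖ ^ 2 := by
      rw [← mul_pow, ← RCLike.norm_conj d, ← norm_mul, ← Complex.normSq_eq_norm_sq,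
        Complex.normSq_apply]; ring
    have e3 : (conj d * (Complex.I * z)).re = -(conj d * z).im := by
      rw [mul_left_comm, Complex.I_mul_re]
    rw [e1, e3, ← mul_assoc, ← e2]; ring
  simp_rw [h2] at h1
  rw [integral_sub ((integrable_norm_sq_mul_circularGaussian h).const_mul _)
    (integrable_sq_linear_mul_circularGaussian h d), integral_const_mul,
    integral_norm_sq_mul_circularGaussian h] at h1
  linarith

/-- The second moment of a real linear statistic of a vector of circular Gaussian variables. -/
theorem lintegral_sq_linear_mul_awgnDensity {N0 : ℝ} (h : 0 < N0) {n : ℕ} (m d : Fin n → ℂ) :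
    ∫⁻ r : Fin n → ℂ, ENNReal.ofReal ((2 / N0 * ∑ k, (conj (d k) * (r k - m k)).re) ^ 2 *
      awgnDensity N0 m r) = ENNReal.ofReal (2 / N0) * ∑ k, ENNReal.ofReal (‖d k‖ ^ 2) := by
  have h1 := lintegral_sub_right_eq_self (μ := (volume : Measure (Fin n → ℂ)))
    (fun r => ENNReal.ofReal ((2 / N0 * ∑ k, (conj (d k) * r k).re) ^ 2 *
      ∏ k, circularGaussian N0 (r k))) m
  have hc := integral_sq_sum_mul_prod (g := circularGaussian N0)
    (l := fun (k : Fin n) z => (conj (d k) * z).re) (integrable_circularGaussian h)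
    (fun k => integrable_linear_mul_circularGaussian h (d k))
    (fun k => integrable_sq_linear_mul_circularGaussian h (d k))
    (integral_circularGaussian h) (fun k => integral_linear_mul_circularGaussian N0 (d k))
  have h2 : ∀ r : Fin n → ℂ, (2 / N0 * ∑ k, (conj (d k) * r k).re) ^ 2 *
      ∏ k, circularGaussian N0 (r k) = (2 / N0) ^ 2 * ((∑ k, (conj (d k) * r k).re) ^ 2 *
      ∏ k, circularGaussian N0 (r k)) := fun r => by ring
  have h3 : ∀ r, awgnDensity N0 m r = ∏ k, circularGaussian N0 ((r - m) k) := fun r => rfl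
  simp_rw [h3]
  simp only [Pi.sub_apply] at h1 ⊢
  rw [h1]
  simp_rw [h2]
  rw [← ofReal_integral_eq_lintegral_ofReal (hc.1.const_mul _) (ae_of_all _ fun r =>
    mul_nonneg (sq_nonneg _) (mul_nonneg (sq_nonneg _)
      (Finset.prod_nonneg fun k _ => circularGaussian_nonneg h _))), integral_const_mul, hc.2,
    ← ENNReal.ofReal_sum_of_nonneg (fun k _ => sq_nonneg _),
    ← ENNReal.ofReal_mul (by positivity)]
  congr 1
  simp_rw [integral_sq_linear_mul_circularGaussian h]
  rw [Finset.mul_sum, Finset.mul_sum]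
  refine Finset.sum_congr rfl fun k _ => ?_
  field_simp

/-! ### The derivative of a tag signal with respect to the Doppler shift -/

/-- The derivative of the signal `b t * exp (j 2π ν (t - t0))` with respect to `ν`. -/
noncomputable def dopplerDeriv (b : ℝ → ℂ) (t0 ν t : ℝ) : ℂ :=
  b t * (2 * Real.pi * Complex.I * (t - t0)) *
    Complex.exp (2 * Real.pi * Complex.I * ν * (t - t0))

theorem norm_doppler_exp (ν t t0 : ℝ) :
    ‖Complex.exp (2 * Real.pi * Complex.I * ν * (t - t0))‖ = 1 := by
  rw [show (2 * Real.pi * Complex.I * ν * (t - t0) : ℂ) =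
    ((2 * Real.pi * ν * (t - t0) : ℝ) : ℂ) * Complex.I by push_cast; ring]
  exact Complex.norm_exp_ofReal_mul_I _

theorem norm_dopplerDeriv (b : ℝ → ℂ) (t0 ν t : ℝ) :
    ‖dopplerDeriv b t0 ν t‖ = ‖b t‖ * (2 * Real.pi * |t - t0|) := by
  rw [dopplerDeriv, norm_mul, norm_doppler_exp, mul_one, norm_mul]
  simp only [norm_mul, Complex.norm_I, ← Complex.ofReal_sub, Complex.norm_real, Real.norm_eq_abs]
  simp [abs_of_pos Real.pi_pos]

/-- This is where the Doppler shift and the data disappear: the phase factor has modulus one, and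
the amplitude enters only through its squared modulus, assumed to be the constant `P` on `A`. -/
theorem norm_sq_dopplerDeriv {b : ℝ → ℂ} {A : Set ℝ} {P : ℝ}
    (hn : ∀ t, ‖b t‖ ^ 2 = A.indicator (fun _ => P) t) (t0 ν t : ℝ) :
    ‖dopplerDeriv b t0 ν t‖ ^ 2 = A.indicator (fun t => 4 * Real.pi ^ 2 * P * (t - t0) ^ 2) t := by
  rw [norm_dopplerDeriv, mul_pow, hn]
  by_cases h : t ∈ A
  · simp only [indicator_of_mem h, mul_pow, sq_abs]; ring
  · simp [indicator_of_notMem h]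

theorem integrable_indicator_of_isBounded {A : Set ℝ} (hA : MeasurableSet A)
    (hbd : Bornology.IsBounded A) {f : ℝ → ℝ} (hf : Continuous f) :
    Integrable (A.indicator f) := by
  rw [integrable_indicator_iff hA]
  exact (hf.continuousOn.integrableOn_compact hbd.isCompact_closure).mono_set subset_closure

theorem memLp_two_of_amplitude {b : ℝ → ℂ} (hb : Measurable b) {A : Set ℝ} {P : ℝ}
    (hA : MeasurableSet A) (hbd : Bornology.IsBounded A)
    (hn : ∀ t, ‖b t‖ ^ 2 = A.indicator (fun _ => P) t) : MemLp b 2 := by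
  rw [memLp_two_iff_integrable_sq_norm hb.aestronglyMeasurable]
  simp_rw [hn]
  exact integrable_indicator_of_isBounded hA hbd continuous_const

theorem memLp_two_dopplerDeriv {b : ℝ → ℂ} (hb : Measurable b) {A : Set ℝ} {P : ℝ}
    (hA : MeasurableSet A) (hbd : Bornology.IsBounded A)
    (hn : ∀ t, ‖b t‖ ^ 2 = A.indicator (fun _ => P) t) (t0 ν : ℝ) :
    MemLp (dopplerDeriv b t0 ν) 2 := by
  have hm : Measurable (dopplerDeriv b t0 ν) := by unfold dopplerDeriv; fun_prop
  rw [memLp_two_iff_integrable_sq_norm hm.aestronglyMeasurable]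
  simp_rw [norm_sq_dopplerDeriv hn]
  exact integrable_indicator_of_isBounded hA hbd (by fun_prop)

theorem integrable_conj_mul (e : Waveform) {f : ℝ → ℂ} (hf : MemLp f 2) :
    Integrable fun t => conj (e t) * f t :=
  (Lp.memLp e).star.integrable_mul hf

theorem coordinate_eq_inner (e : Waveform) {f : ℝ → ℂ} (hf : MemLp f 2) :
    coordinate e f = inner ℂ e (hf.toLp f) := by
  rw [L2.inner_def, coordinate]
  refine integral_congr_ae ?_
  filter_upwards [hf.coeFn_toLp] with t ht
  rw [ht, RCLike.inner_apply, mul_comm]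

theorem norm_toLp_sq {f : ℝ → ℂ} (hf : MemLp f 2) : ‖hf.toLp f‖ ^ 2 = ∫ t, ‖f t‖ ^ 2 := by
  have h : ((‖hf.toLp f‖ ^ 2 : ℝ) : ℂ) = ((∫ t, ‖f t‖ ^ 2 : ℝ) : ℂ) := by
    have h1 := inner_self_eq_norm_sq_to_K (𝕜 := ℂ) (hf.toLp f)
    rw [Complex.ofReal_pow]
    refine h1.symm.trans ?_
    rw [L2.inner_def, ← integral_complex_ofReal]
    refine integral_congr_ae ?_
    filter_upwards [hf.coeFn_toLp] with t ht
    rw [ht, inner_self_eq_norm_sq_to_K]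
    simp
  exact_mod_cast h

/-- Differentiation under the integral sign. The modulus of the derivative of the integrand does not
depend on the Doppler shift, so its value at `ν` is a dominating function for all shifts at once. -/
theorem hasDerivAt_coordinate {Ω : Type*} {a : Ω → ℝ → ℂ} {u : Ω} (hb : Measurable (a u))
    {A : Set ℝ} {P : ℝ} (hA : MeasurableSet A) (hbd : Bornology.IsBounded A)
    (hn : ∀ t, ‖a u t‖ ^ 2 = A.indicator (fun _ => P) t) (e : Waveform) (t0 ν : ℝ) :
    HasDerivAt (fun ν' => coordinate e (tagSignal a t0 ν' u))
      (coordinate e (dopplerDeriv (a u) t0 ν)) ν := by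
  have hs : ∀ ν', Measurable (tagSignal a t0 ν' u) := by
    intro ν'; unfold tagSignal; fun_prop
  have hsL : MemLp (tagSignal a t0 ν u) 2 := by
    refine memLp_two_of_amplitude (hs ν) hA hbd (P := P) fun t => ?_
    rw [tagSignal, norm_mul, norm_doppler_exp, mul_one, hn]
  have hd := memLp_two_dopplerDeriv hb hA hbd hn t0 ν
  have he : AEStronglyMeasurable (fun t => conj (e t)) volume := (Lp.memLp e).star.1
  refine (hasDerivAt_integral_of_dominated_loc_of_deriv_le
    (bound := fun t => ‖conj (e t) * dopplerDeriv (a u) t0 ν t‖)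
    (F' := fun ν' t => conj (e t) * dopplerDeriv (a u) t0 ν' t)
    Filter.univ_mem (.of_forall fun ν' => he.mul (hs ν').aestronglyMeasurable)
    (integrable_conj_mul e hsL) (he.mul hd.1) (ae_of_all _ fun t ν' _ => ?_)
    (integrable_conj_mul e hd).norm (ae_of_all _ fun t ν' _ => ?_)).2
  · simp [norm_dopplerDeriv]
  · have h1 : HasDerivAt (fun x : ℝ => (2 * Real.pi * Complex.I * x * (t - t0) : ℂ))
        (2 * Real.pi * Complex.I * (t - t0)) ν' := by
      have := ((Complex.ofRealCLM.hasDerivAt (x := ν')).const_mul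
        (2 * Real.pi * Complex.I)).mul_const ((t - t0 : ℂ))
      simpa using this
    have h2 := (h1.cexp.const_mul (a u t)).const_mul (conj (e t))
    refine h2.congr_deriv ?_
    simp only [dopplerDeriv]; ring

/-- The score is a linear statistic of the noise. -/
theorem score_eq {Ω : Type*} {s : ℝ → Ω → ℝ → ℂ} {N0 : ℝ} (h : 0 < N0) {n : ℕ}
    {e : Fin n → Waveform} {u : Ω} {ν : ℝ} {d : Fin n → ℂ}
    (hd : ∀ k, HasDerivAt (fun ν' => coordinate (e k) (s ν' u)) (d k) ν) (r : Fin n → ℂ) :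
    score N0 s e u ν r =
      2 / N0 * ∑ k, (conj (d k) * (r k - coordinate (e k) (s ν u))).re := by
  have hlog : ∀ ν', Real.log (likelihood N0 s e u ν' r) = ∑ k, (Real.log (Real.pi * N0)⁻¹ -
      ‖r k - coordinate (e k) (s ν' u)‖ ^ 2 / N0) := by
    intro ν'
    have hc : (Real.pi * N0)⁻¹ ≠ 0 := by positivity
    rw [likelihood, awgnDensity, Real.log_prod fun k _ => mul_ne_zero hc (Real.exp_ne_zero _)]
    refine Finset.sum_congr rfl fun k _ => ?_
    rw [Real.log_mul hc (Real.exp_ne_zero _), Real.log_exp]; ring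
  unfold score
  simp_rw [hlog]
  have := HasDerivAt.fun_sum (u := Finset.univ) fun (k : Fin n) _ =>
    ((((hd k).const_sub (r k)).norm_sq).div_const N0).const_sub (Real.log (Real.pi * N0)⁻¹)
  rw [this.deriv, Finset.mul_sum]
  refine Finset.sum_congr rfl fun k _ => ?_
  rw [inner_neg_right, real_inner_comm, Complex.inner, mul_comm (conj (d k))]
  ring

/-- The noise is averaged out for each fixed value of the data. Any finite family `e` is allowed;
orthonormality matters only for the supremum. -/
theorem modifiedInformationAlong_tagSignal {Ω : Type*} [MeasurableSpace Ω] (Q : Measure Ω)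
    {N0 : ℝ} (h : 0 < N0) {a : Ω → ℝ → ℂ} (ha : ∀ u, Measurable (a u)) {A : Set ℝ} {P : ℝ}
    (hA : MeasurableSet A) (hbd : Bornology.IsBounded A)
    (hn : ∀ u t, ‖a u t‖ ^ 2 = A.indicator (fun _ => P) t) (t0 ν : ℝ) {n : ℕ}
    (e : Fin n → Waveform) :
    modifiedInformationAlong Q N0 (tagSignal a t0) ν e = ENNReal.ofReal (2 / N0) *
      ∫⁻ u, ∑ k, ENNReal.ofReal (‖coordinate (e k) (dopplerDeriv (a u) t0 ν)‖ ^ 2) ∂Q := by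
  rw [modifiedInformationAlong, ← lintegral_const_mul' _ _ ENNReal.ofReal_ne_top]
  refine lintegral_congr fun u => ?_
  simp_rw [score_eq h fun k => hasDerivAt_coordinate (ha u) hA hbd (hn u) (e k) t0 ν]
  exact lintegral_sq_linear_mul_awgnDensity h _ _

/-! ### The information in the continuous-time observation -/

/-- Distinct orthonormal vectors are at distance `√2`, so balls of radius `1 / 2` about them are
disjoint. Countability is needed to exchange the sum over a Hilbert basis with the integral over the
data. -/
theorem Orthonormal.countable_index {ι 𝕜 E : Type*} [RCLike 𝕜] [NormedAddCommGroup E]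
    [InnerProductSpace 𝕜 E] [TopologicalSpace.SeparableSpace E] {v : ι → E}
    (hv : Orthonormal 𝕜 v) : Countable ι := by
  refine Pairwise.countable_of_isOpen_disjoint (s := fun i => Metric.ball (v i) (1 / 2)) ?_
    (fun _ => Metric.isOpen_ball) fun i => ⟨v i, Metric.mem_ball_self (by norm_num)⟩
  intro i j hij
  refine Metric.ball_disjoint_ball ?_
  have h1 : ‖v i - v j‖ ^ 2 = 2 := by
    rw [@norm_sub_sq 𝕜, hv.2 hij, hv.1, hv.1]; norm_num
  rw [dist_eq_norm]
  nlinarith [norm_nonneg (v i - v j)]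

theorem HilbertBasis.tsum_ofReal_norm_inner_sq {ι E : Type*} [NormedAddCommGroup E]
    [InnerProductSpace ℂ E] (b : HilbertBasis ι ℂ E) (x : E) :
    ∑' i, ENNReal.ofReal (‖inner ℂ (b i) x‖ ^ 2) = ENNReal.ofReal (‖x‖ ^ 2) := by
  have h1 := Complex.hasSum_re (b.hasSum_inner_mul_inner x x)
  have h2 : ∀ i, (inner ℂ x (b i) * inner ℂ (b i) x).re = ‖inner ℂ (b i) x‖ ^ 2 := by
    intro i
    rw [← inner_conj_symm, RCLike.conj_mul]
    norm_cast
  simp_rw [h2] at h1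
  have h3 : (inner ℂ x x).re = ‖x‖ ^ 2 := by
    rw [inner_self_eq_norm_sq_to_K]; norm_cast
  rw [h3] at h1
  rw [← h1.tsum_eq, ENNReal.ofReal_tsum_of_nonneg (fun i => sq_nonneg _) h1.summable]

theorem measurable_coordinate_dopplerDeriv {Ω : Type*} [MeasurableSpace Ω] {a : Ω → ℝ → ℂ}
    (ha : Measurable (Function.uncurry a)) (e : Waveform) (t0 ν : ℝ) :
    Measurable fun u => coordinate e (dopplerDeriv (a u) t0 ν) := by
  refine (StronglyMeasurable.integral_prod_right
    (f := fun (u : Ω) (t : ℝ) => conj (e t) * dopplerDeriv (a u) t0 ν t) ?_).measurable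
  refine Measurable.stronglyMeasurable ?_
  have he : Measurable fun p : Ω × ℝ => (e p.2 : ℂ) :=
    (Lp.stronglyMeasurable e).measurable.comp measurable_snd
  have ha' : Measurable fun p : Ω × ℝ => a p.1 p.2 := ha
  have hc : Measurable fun p : Ω × ℝ => conj (e p.2 : ℂ) := Complex.continuous_conj.measurable.comp he
  unfold dopplerDeriv Function.uncurry
  fun_prop

/-- The upper bound is Bessel's inequality for each value of the data. For the lower bound, finite
subfamilies of a single Hilbert basis suffice: by Parseval and monotone convergence their
informations have the full norm as supremum, and this norm is the same for all data. -/
theorem modifiedInformation_tagSignal {Ω : Type*} [MeasurableSpace Ω] (Q : Measure Ω)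
    [IsProbabilityMeasure Q] {N0 : ℝ} (h : 0 < N0) {a : Ω → ℝ → ℂ}
    (ha : Measurable (Function.uncurry a)) {A : Set ℝ} {P : ℝ}
    (hA : MeasurableSet A) (hbd : Bornology.IsBounded A)
    (hn : ∀ u t, ‖a u t‖ ^ 2 = A.indicator (fun _ => P) t) (t0 ν : ℝ) :
    modifiedInformation Q N0 (tagSignal a t0) ν =
      ENNReal.ofReal (8 * Real.pi ^ 2 * P / N0 * ∫ t in A, (t - t0) ^ 2) := by
  have hau : ∀ u, Measurable (a u) := fun u => ha.comp measurable_prodMk_left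
  have hL : ∀ u, MemLp (dopplerDeriv (a u) t0 ν) 2 := fun u =>
    memLp_two_dopplerDeriv (hau u) hA hbd (hn u) t0 ν
  have hnorm : ∀ u, ‖(hL u).toLp _‖ ^ 2 = 4 * Real.pi ^ 2 * P * ∫ t in A, (t - t0) ^ 2 := by
    intro u
    rw [norm_toLp_sq]
    simp_rw [norm_sq_dopplerDeriv (hn u)]
    rw [integral_indicator hA, integral_const_mul]
  have hval : 8 * Real.pi ^ 2 * P / N0 * ∫ t in A, (t - t0) ^ 2 =
      2 / N0 * (4 * Real.pi ^ 2 * P * ∫ t in A, (t - t0) ^ 2) := by ring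
  rw [hval, ENNReal.ofReal_mul (by positivity)]
  have hcoord : ∀ u (e : Waveform), coordinate e (dopplerDeriv (a u) t0 ν) =
      inner ℂ e ((hL u).toLp _) := fun u e => coordinate_eq_inner e (hL u)
  refine le_antisymm ?_ ?_
  · refine iSup_le fun n => iSup_le fun e => iSup_le fun he => ?_
    rw [modifiedInformationAlong_tagSignal Q h hau hA hbd hn]
    gcongr
    calc ∫⁻ u, ∑ k, ENNReal.ofReal (‖coordinate (e k) (dopplerDeriv (a u) t0 ν)‖ ^ 2) ∂Q
        ≤ ∫⁻ _, ENNReal.ofReal (4 * Real.pi ^ 2 * P * ∫ t in A, (t - t0) ^ 2) ∂Q := by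
          refine lintegral_mono fun u => ?_
          rw [← ENNReal.ofReal_sum_of_nonneg fun k _ => sq_nonneg _]
          refine ENNReal.ofReal_le_ofReal ?_
          simp_rw [hcoord]
          rw [← hnorm u]
          exact he.sum_inner_products_le _
      _ = _ := by simp
  · obtain ⟨w, b, -⟩ := exists_hilbertBasis ℂ Waveform
    -- Separability of L² is inferred from the finiteness of the exponent.
    have : Fact ((2 : ℝ≥0∞) ≠ ∞) := ⟨by simp⟩
    have : Countable w := b.orthonormal.countable_index
    have hint : ENNReal.ofReal (4 * Real.pi ^ 2 * P * ∫ t in A, (t - t0) ^ 2) =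
        ⨆ F : Finset w, ∫⁻ u, ∑ i ∈ F,
          ENNReal.ofReal (‖coordinate (b i) (dopplerDeriv (a u) t0 ν)‖ ^ 2) ∂Q := by
      have hm : ∀ i : w, Measurable fun u =>
          ENNReal.ofReal (‖coordinate (b i) (dopplerDeriv (a u) t0 ν)‖ ^ 2) := fun i =>
        ((measurable_coordinate_dopplerDeriv ha (b i) t0 ν).norm.pow_const 2).ennreal_ofReal
      simp_rw [lintegral_finsetSum _ fun i _ => hm i]
      rw [← ENNReal.tsum_eq_iSup_sum, ← lintegral_tsum fun i => (hm i).aemeasurable]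
      simp_rw [hcoord, b.tsum_ofReal_norm_inner_sq, hnorm]
      simp
    rw [hint, ENNReal.mul_iSup]
    refine iSup_le fun F => ?_
    have he : Orthonormal ℂ fun k : Fin F.card => b (F.equivFin.symm k) :=
      b.orthonormal.comp _ (Subtype.val_injective.comp F.equivFin.symm.injective)
    refine le_trans (le_of_eq ?_) (le_iSup_of_le F.card (le_iSup_of_le _
      (le_iSup (fun _ => modifiedInformationAlong Q N0 (tagSignal a t0) ν _) he)))
    rw [modifiedInformationAlong_tagSignal Q h hau hA hbd hn]
    congr 1
    refine lintegral_congr fun u => ?_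
    rw [F.equivFin.symm.sum_comp (fun i : F =>
      ENNReal.ofReal (‖coordinate (b i) (dopplerDeriv (a u) t0 ν)‖ ^ 2)),
      Finset.sum_coe_sort F fun i =>
      ENNReal.ofReal (‖coordinate (b i) (dopplerDeriv (a u) t0 ν)‖ ^ 2)]

/-! ### The bound for signals with a given second moment -/

/-- Here `c` is the centroid, `M` the total energy and `PS * C / 12` the central moment of inertia
of the energy. The normalisation by 12 gives `C = T ^ 3` for constant power `PS` on an interval of
length `T`. At `t0 = c` the information is `2π² * PS * C / (3 * N0)`. -/
theorem isDopplerMCRB_of_secondMoment {Ω : Type*} [MeasurableSpace Ω] (Q : Measure Ω)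
    [IsProbabilityMeasure Q] {N0 PS P : ℝ} (hN : 0 < N0) (hPS : 0 < PS) {a : Ω → ℝ → ℂ}
    (ha : Measurable (Function.uncurry a)) {A : Set ℝ} (hA : MeasurableSet A)
    (hbd : Bornology.IsBounded A) (hn : ∀ u t, ‖a u t‖ ^ 2 = A.indicator (fun _ => P) t)
    (ν : ℝ) {C M c : ℝ} (hC : 0 < C) (hM : 0 ≤ M)
    (hint : ∀ t0, P * ∫ t in A, (t - t0) ^ 2 = PS * C / 12 + M * (t0 - c) ^ 2) :
    IsDopplerMCRB Q N0 a ν (sigmaSqMCRB N0 PS C) := by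
  have hpi := Real.pi_pos
  have hinfo : ∀ t0, MCRB Q N0 (tagSignal a t0) ν =
      (ENNReal.ofReal (8 * Real.pi ^ 2 / N0 * (PS * C / 12 + M * (t0 - c) ^ 2)))⁻¹ := by
    intro t0
    rw [MCRB, modifiedInformation_tagSignal Q hN ha hA hbd hn, ← hint]
    congr 2; ring
  have hσ : ENNReal.ofReal (sigmaSqMCRB N0 PS C) =
      (ENNReal.ofReal (8 * Real.pi ^ 2 / N0 * (PS * C / 12)))⁻¹ := by
    rw [← ENNReal.ofReal_inv_of_pos (by positivity), sigmaSqMCRB]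
    congr 1
    field_simp
    norm_num
  refine ⟨by unfold sigmaSqMCRB; positivity, ⟨c, ?_⟩, ?_⟩
  · simp only [hinfo, hσ]; simp
  · rintro _ ⟨t0, rfl⟩
    simp only [hinfo, hσ]
    rw [ENNReal.inv_le_inv]
    refine ENNReal.ofReal_le_ofReal (mul_le_mul_of_nonneg_left ?_ (by positivity))
    have : 0 ≤ M * (t0 - c) ^ 2 := by positivity
    linarith

/-! ### Second moments of transmission times -/

theorem setIntegral_sub_sq_Ico (b l t0 : ℝ) (hl : 0 ≤ l) :
    ∫ t in Ico b (b + l), (t - t0) ^ 2 = l ^ 3 / 12 + l * (t0 - (b + l / 2)) ^ 2 := by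
  rw [integral_Ico_eq_integral_Ioc, ← intervalIntegral.integral_of_le (by linarith),
    intervalIntegral.integral_comp_sub_right (fun t => t ^ 2), integral_pow]
  norm_num
  ring

theorem setIntegral_sub_sq_union {A B : Set ℝ} (hB : MeasurableSet B) (hAB : Disjoint A B)
    (hbA : Bornology.IsBounded A) (hbB : Bornology.IsBounded B) (t0 : ℝ) :
    ∫ t in A ∪ B, (t - t0) ^ 2 = (∫ t in A, (t - t0) ^ 2) + ∫ t in B, (t - t0) ^ 2 := by
  have hf : Continuous fun t : ℝ => (t - t0) ^ 2 := by fun_prop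
  have hi : ∀ {S : Set ℝ}, Bornology.IsBounded S → IntegrableOn (fun t => (t - t0) ^ 2) S :=
    fun hS => (hf.continuousOn.integrableOn_compact hS.isCompact_closure).mono_set subset_closure
  exact setIntegral_union hAB hB (hi hbA) (hi hbB)

/-- The parallel axis theorem for two point masses. -/
theorem parallel_axis {m₁ m₂ : ℝ} (h : m₁ + m₂ ≠ 0) (c₁ c₂ x : ℝ) :
    m₁ * (x - c₁) ^ 2 + m₂ * (x - c₂) ^ 2 =
      m₁ * m₂ / (m₁ + m₂) * (c₂ - c₁) ^ 2 +
        (m₁ + m₂) * (x - (m₁ * c₁ + m₂ * c₂) / (m₁ + m₂)) ^ 2 := by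
  field_simp
  ring

theorem reflectTimes_succ (b T : ℝ) (L : ℕ) :
    reflectTimes b T (L + 1) = reflectTimes b T L ∪ Ico (b + L * T) (b + L * T + T / 2) := by
  rw [reflectTimes, Finset.range_add_one, Finset.set_biUnion_insert, union_comm]; rfl

theorem measurableSet_reflectTimes (b T : ℝ) (L : ℕ) : MeasurableSet (reflectTimes b T L) :=
  Finset.measurableSet_biUnion _ fun _ _ => measurableSet_Ico

theorem reflectTimes_subset (b : ℝ) {T : ℝ} (hT : 0 ≤ T) (L : ℕ) :
    reflectTimes b T L ⊆ Ico b (b + L * T) := by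
  induction L with
  | zero => simp [reflectTimes]
  | succ L ih =>
    rw [reflectTimes_succ]
    have : 0 ≤ L * T := by positivity
    push_cast
    exact union_subset (ih.trans (Ico_subset_Ico_right (by nlinarith)))
      (Ico_subset_Ico (by linarith) (by linarith))

theorem isBounded_reflectTimes (b : ℝ) {T : ℝ} (hT : 0 ≤ T) (L : ℕ) :
    Bornology.IsBounded (reflectTimes b T L) :=
  (Metric.isBounded_Ico _ _).subset (reflectTimes_subset b hT L)

/-- The silent second half of the last symbol moves the centroid a quarter symbol ahead of the
middle of the part. The induction adds one window of length `T / 2` at a time. -/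
theorem setIntegral_sub_sq_reflectTimes (b : ℝ) {T : ℝ} (hT : 0 ≤ T) (L : ℕ) (t0 : ℝ) :
    ∫ t in reflectTimes b T L, (t - t0) ^ 2 =
      ((L * T) ^ 3 - 3 / 4 * (L * T) * T ^ 2) / 24 +
        L * T / 2 * (t0 - (b + L * T / 2 - T / 4)) ^ 2 := by
  induction L with
  | zero => simp [reflectTimes]
  | succ L ih =>
    have hd : Disjoint (reflectTimes b T L) (Ico (b + L * T) (b + L * T + T / 2)) :=
      disjoint_of_subset_left (reflectTimes_subset b hT L) Ico_disjoint_Ico_same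
    rw [reflectTimes_succ, setIntegral_sub_sq_union measurableSet_Ico hd
      (isBounded_reflectTimes b hT L) (Metric.isBounded_Ico _ _), ih,
      setIntegral_sub_sq_Ico _ _ _ (by linarith)]
    push_cast
    ring

/-! ### Amplitudes -/

theorem measurable_uncurry_pskAmplitude {Ω : Type*} [MeasurableSpace Ω] (PS : ℝ) {S : Set ℝ}
    (hS : MeasurableSet S) {x : Ω → ℝ → Bool} (hx : Measurable (Function.uncurry x)) :
    Measurable (Function.uncurry (pskAmplitude PS S x)) := by
  unfold pskAmplitude Function.uncurry
  refine Measurable.ite (measurable_snd hS) (Measurable.ite ?_ ?_ ?_) measurable_const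
  · exact hx (measurableSet_singleton true)
  · exact measurable_const
  · exact measurable_const

theorem norm_sq_pskAmplitude {Ω : Type*} {PS : ℝ} (hPS : 0 ≤ PS) (S : Set ℝ) (x : Ω → ℝ → Bool)
    (u : Ω) (t : ℝ) : ‖pskAmplitude PS S x u t‖ ^ 2 = S.indicator (fun _ => PS) t := by
  unfold pskAmplitude indicator
  split_ifs <;> simp [Real.sq_sqrt hPS]

theorem measurable_uncurry_askAmplitude (PS : ℝ) {R : Set ℝ} (hR : MeasurableSet R) :
    Measurable (Function.uncurry (askAmplitude PS R)) := by
  unfold askAmplitude Function.uncurry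
  exact Measurable.ite (measurable_snd hR) measurable_const measurable_const

theorem norm_sq_askAmplitude {PS : ℝ} (hPS : 0 ≤ PS) (R : Set ℝ) (u : Unit) (t : ℝ) :
    ‖askAmplitude PS R u t‖ ^ 2 = R.indicator (fun _ => 2 * PS) t := by
  unfold askAmplitude indicator
  split_ifs
  · rw [Complex.norm_real, Real.norm_of_nonneg (Real.sqrt_nonneg _), Real.sq_sqrt (by positivity)]
  · simp

/-! ### The four transmission schemes -/

/-- The parallel axis form: the inertia of each part, plus the reduced mass times the squared
distance `(T1 + T2) / 2 + Tp` between the centres. -/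
theorem CTtwo_eq {T1 T2 : ℝ} (h : T1 + T2 ≠ 0) (Tp : ℝ) :
    CTtwo T1 T2 Tp =
      T1 ^ 3 + T2 ^ 3 + 12 * (T1 * T2 / (T1 + T2)) * ((T1 + T2) / 2 + Tp) ^ 2 := by
  unfold CTtwo
  field_simp
  ring

theorem isDopplerMCRB_psk_onePart {Ω : Type*} [MeasurableSpace Ω] (Q : Measure Ω)
    [IsProbabilityMeasure Q] {x : Ω → ℝ → Bool} (hx : Measurable (Function.uncurry x))
    {N0 PS T0 : ℝ} (ν : ℝ) (hN : 0 < N0) (hPS : 0 < PS) (hT : 0 < T0) :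
    IsDopplerMCRB Q N0 (pskAmplitude PS (onePart T0) x) ν (sigmaSqMCRB N0 PS (CTone T0)) := by
  refine isDopplerMCRB_of_secondMoment Q hN hPS
    (measurable_uncurry_pskAmplitude PS measurableSet_Ico hx) measurableSet_Ico
    (Metric.isBounded_Ico _ _) (norm_sq_pskAmplitude hPS.le _ x) ν (c := T0 / 2) (M := PS * T0)
    (pow_pos hT 3) (by positivity) fun t0 => ?_
  have := setIntegral_sub_sq_Ico 0 T0 t0 hT.le
  rw [zero_add, zero_add] at this
  rw [this, CTone]; ring

theorem isDopplerMCRB_psk_twoParts {Ω : Type*} [MeasurableSpace Ω] (Q : Measure Ω)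
    [IsProbabilityMeasure Q] {x : Ω → ℝ → Bool} (hx : Measurable (Function.uncurry x))
    {N0 PS T1 T2 Tp : ℝ} (ν : ℝ) (hN : 0 < N0) (hPS : 0 < PS) (hT1 : 0 < T1) (hT2 : 0 < T2)
    (hTp : 0 ≤ Tp) :
    IsDopplerMCRB Q N0 (pskAmplitude PS (twoParts T1 T2 Tp) x) ν
      (sigmaSqMCRB N0 PS (CTtwo T1 T2 Tp)) := by
  have hm : MeasurableSet (twoParts T1 T2 Tp) := measurableSet_Ico.union measurableSet_Ico
  have hd : Disjoint (Ico 0 T1) (Ico (T1 + Tp) (T1 + Tp + T2)) :=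
    Ico_disjoint_Ico.2 (by simp [hTp])
  refine isDopplerMCRB_of_secondMoment Q hN hPS
    (measurable_uncurry_pskAmplitude PS hm hx) hm
    ((Metric.isBounded_Ico _ _).union (Metric.isBounded_Ico _ _))
    (norm_sq_pskAmplitude hPS.le _ x) ν (M := PS * (T1 + T2))
    -- The centroid of the two parts, as in `parallel_axis`.
    (c := (T1 * (T1 / 2) + T2 * (T1 + Tp + T2 / 2)) / (T1 + T2))
    (by unfold CTtwo; positivity) (by positivity) fun t0 => ?_
  have h1 := setIntegral_sub_sq_Ico 0 T1 t0 hT1.le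
  rw [zero_add, zero_add] at h1
  rw [twoParts, setIntegral_sub_sq_union measurableSet_Ico hd (Metric.isBounded_Ico _ _)
    (Metric.isBounded_Ico _ _), h1, setIntegral_sub_sq_Ico _ _ _ hT2.le, CTtwo_eq (by positivity)]
  linear_combination PS * parallel_axis (by positivity : T1 + T2 ≠ 0) (T1 / 2)
    (T1 + Tp + T2 / 2) t0

theorem isDopplerMCRB_ask_onePart (L : ℕ) {N0 PS T : ℝ} (ν : ℝ) (hL : 1 ≤ L) (hN : 0 < N0)
    (hPS : 0 < PS) (hT : 0 < T) :
    IsDopplerMCRB (Measure.dirac ()) N0 (askAmplitude PS (reflectTimes 0 T L)) ν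
      (sigmaSqMCRB N0 PS ((L * T) ^ 3 - 3 / 4 * (L * T) * T ^ 2)) := by
  have hm := measurableSet_reflectTimes 0 T L
  have hL' : (1 : ℝ) ≤ L := by exact_mod_cast hL
  have hTL : T ≤ L * T := by nlinarith
  refine isDopplerMCRB_of_secondMoment _ hN hPS
    (measurable_uncurry_askAmplitude PS hm) hm (isBounded_reflectTimes 0 hT.le L)
    (norm_sq_askAmplitude hPS.le _) ν (M := PS * (L * T)) (c := 0 + L * T / 2 - T / 4)
    ?_ (by positivity) fun t0 => ?_
  · have h1 : T ^ 2 ≤ (L * T) ^ 2 := by gcongr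
    have h2 : 0 < L * T := by linarith
    nlinarith [mul_le_mul_of_nonneg_left h1 h2.le, pow_pos h2 3]
  · rw [setIntegral_sub_sq_reflectTimes 0 hT.le]; ring

/-- The centroids of the parts move back by `τ1 / 4` and `τ2 / 4`, so the distance between them
changes by `(τ1 - τ2) / 4`. -/
theorem isDopplerMCRB_ask_twoParts (L1 L2 : ℕ) {N0 PS τ1 τ2 Tp : ℝ} (ν : ℝ) (hL1 : 1 ≤ L1)
    (hL2 : 1 ≤ L2) (hN : 0 < N0) (hPS : 0 < PS) (hτ1 : 0 < τ1) (hτ2 : 0 < τ2) (hTp : 0 ≤ Tp) :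
    IsDopplerMCRB (Measure.dirac ()) N0
      (askAmplitude PS (reflectTimes 0 τ1 L1 ∪ reflectTimes (L1 * τ1 + Tp) τ2 L2)) ν
      (sigmaSqMCRB N0 PS (((L1 * τ1) ^ 3 - 3 / 4 * (L1 * τ1) * τ1 ^ 2) +
        ((L2 * τ2) ^ 3 - 3 / 4 * (L2 * τ2) * τ2 ^ 2) +
        12 * (L1 * τ1 * (L2 * τ2) / (L1 * τ1 + L2 * τ2)) *
          ((L1 * τ1 + L2 * τ2) / 2 + Tp + (τ1 - τ2) / 4) ^ 2)) := by
  have hpos : ∀ {L : ℕ} {τ : ℝ}, 1 ≤ L → 0 < τ → 0 < L * τ ∧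
      0 < (L * τ) ^ 3 - 3 / 4 * (L * τ) * τ ^ 2 := by
    intro L τ hL hτ
    have hL' : (1 : ℝ) ≤ L := by exact_mod_cast hL
    have h0 : τ ≤ L * τ := by nlinarith
    have h1 : τ ^ 2 ≤ (L * τ) ^ 2 := by gcongr
    have h2 : 0 < L * τ := by linarith
    exact ⟨h2, by nlinarith [mul_le_mul_of_nonneg_left h1 h2.le, pow_pos h2 3]⟩
  obtain ⟨hT1, hV1⟩ := hpos hL1 hτ1
  obtain ⟨hT2, hV2⟩ := hpos hL2 hτ2
  have hm := (measurableSet_reflectTimes 0 τ1 L1).union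
    (measurableSet_reflectTimes (L1 * τ1 + Tp) τ2 L2)
  have hd : Disjoint (reflectTimes 0 τ1 L1) (reflectTimes (L1 * τ1 + Tp) τ2 L2) := by
    refine Disjoint.mono (reflectTimes_subset 0 hτ1.le L1)
      (reflectTimes_subset (L1 * τ1 + Tp) hτ2.le L2) (Ico_disjoint_Ico.2 ?_)
    simp [hTp]
  refine isDopplerMCRB_of_secondMoment _ hN hPS
    (measurable_uncurry_askAmplitude PS hm) hm
    ((isBounded_reflectTimes 0 hτ1.le L1).union (isBounded_reflectTimes _ hτ2.le L2))
    (norm_sq_askAmplitude hPS.le _) ν (M := PS * (L1 * τ1 + L2 * τ2))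
    (c := (L1 * τ1 * (0 + L1 * τ1 / 2 - τ1 / 4) +
      L2 * τ2 * (L1 * τ1 + Tp + L2 * τ2 / 2 - τ2 / 4)) / (L1 * τ1 + L2 * τ2))
    (by positivity) (by positivity) fun t0 => ?_
  rw [setIntegral_sub_sq_union (measurableSet_reflectTimes _ _ _) hd
    (isBounded_reflectTimes 0 hτ1.le L1) (isBounded_reflectTimes _ hτ2.le L2),
    setIntegral_sub_sq_reflectTimes 0 hτ1.le, setIntegral_sub_sq_reflectTimes _ hτ2.le]
  linear_combination PS * parallel_axis (by positivity : L1 * τ1 + L2 * τ2 ≠ 0)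
    (0 + L1 * τ1 / 2 - τ1 / 4) (L1 * τ1 + Tp + L2 * τ2 / 2 - τ2 / 4) t0

/-! ### Approximation for many symbols -/

/-- The bound is inversely proportional to `C`, so a relative error `η` in `C` becomes at most `η /
(1 - η)`, which is at most `2 * η` for `η ≤ 1 / 2`. -/
theorem abs_sigmaSqMCRB_sub_le {N0 PS C C' η : ℝ} (hN : 0 < N0) (hPS : 0 < PS) (hC : 0 < C)
    (hη : η ≤ 1 / 2) (h : |C' - C| ≤ η * C) :
    |sigmaSqMCRB N0 PS C' - sigmaSqMCRB N0 PS C| ≤ 2 * η * sigmaSqMCRB N0 PS C := by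
  have hpi := Real.pi_pos
  have hC' : C ≤ 2 * C' := by
    have := (abs_le.1 h).1
    nlinarith
  have hC'0 : 0 < C' := by linarith
  have e : sigmaSqMCRB N0 PS C' - sigmaSqMCRB N0 PS C =
      sigmaSqMCRB N0 PS C * ((C - C') / C') := by
    unfold sigmaSqMCRB; field_simp
  have hσ : 0 < sigmaSqMCRB N0 PS C := by unfold sigmaSqMCRB; positivity
  rw [e, abs_mul, abs_of_pos hσ, mul_comm]
  refine mul_le_mul_of_nonneg_right ?_ hσ.le
  rw [abs_div, abs_of_pos hC'0, abs_sub_comm, div_le_iff₀ hC'0]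
  have : 0 ≤ η := by
    by_contra hneg
    nlinarith [abs_nonneg (C' - C)]
  nlinarith

theorem exists_nat_two_div_le {ε : ℝ} (hε : 0 < ε) :
    ∃ L₀ : ℕ, 1 ≤ L₀ ∧ 2 / (L₀ : ℝ) ≤ 1 / 2 ∧ 2 * (2 / (L₀ : ℝ)) ≤ ε := by
  obtain ⟨n, hn⟩ := exists_nat_ge (4 / ε)
  -- The summand 4 secures `2 / L₀ ≤ 1 / 2`, and `n ≥ 4 / ε` secures `4 / L₀ ≤ ε`.
  refine ⟨n + 4, by omega, ?_, ?_⟩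
  · rw [div_le_iff₀ (by positivity)]
    push_cast
    linarith [(n.cast_nonneg : (0 : ℝ) ≤ n)]
  · rw [div_le_iff₀ hε] at hn
    rw [← mul_div_assoc, div_le_iff₀ (by positivity)]
    push_cast
    nlinarith

theorem symbol_moment_error {T τ x : ℝ} (hτ : 0 ≤ τ) (hT : 0 ≤ T) (hx : x ≤ 1)
    (h : τ ≤ x * T) (hx0 : 0 ≤ x) : 3 / 4 * T * τ ^ 2 ≤ x * T ^ 3 := by
  have h1 : τ ^ 2 ≤ (x * T) ^ 2 := by gcongr
  have h2 : x ^ 2 ≤ x := by nlinarith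
  calc 3 / 4 * T * τ ^ 2 ≤ 1 * T * (x * T) ^ 2 := by gcongr; norm_num
    _ = x ^ 2 * T ^ 3 := by ring
    _ ≤ x * T ^ 3 := by gcongr

/-- All terms of `CTtwo_eq` are nonnegative, so it is enough to bound the relative error of each.
The centroid shift `δ` is at most `x * (T1 + T2) / 4`, hence at most `x * D / 2` whatever the pause,
since a pause only increases the distance `D`. -/
theorem abs_ask_twoParts_sub_CTtwo_le {T1 T2 Tp τ1 τ2 x : ℝ} (hT1 : 0 < T1) (hT2 : 0 < T2)
    (hTp : 0 ≤ Tp) (hτ1 : 0 ≤ τ1) (hτ2 : 0 ≤ τ2) (hx0 : 0 ≤ x) (hx : x ≤ 1)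
    (h1 : τ1 ≤ x * T1) (h2 : τ2 ≤ x * T2) :
    |((T1 ^ 3 - 3 / 4 * T1 * τ1 ^ 2) + (T2 ^ 3 - 3 / 4 * T2 * τ2 ^ 2) +
      12 * (T1 * T2 / (T1 + T2)) * ((T1 + T2) / 2 + Tp + (τ1 - τ2) / 4) ^ 2) -
        CTtwo T1 T2 Tp| ≤ 2 * x * CTtwo T1 T2 Tp := by
  rw [CTtwo_eq (by positivity)]
  set D := (T1 + T2) / 2 + Tp with hD
  set δ := (τ1 - τ2) / 4 with hδ
  set K := 12 * (T1 * T2 / (T1 + T2)) with hK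
  have hK0 : 0 ≤ K := by positivity
  have hD0 : 0 < D := by positivity
  have e1 := symbol_moment_error hτ1 hT1.le hx h1 hx0
  have e2 := symbol_moment_error hτ2 hT2.le hx h2 hx0
  have hδ1 : |δ| ≤ x * D / 2 := by
    have : 0 ≤ x * Tp := by positivity
    have a1 : 0 ≤ x * T1 := by positivity
    have a2 : 0 ≤ x * T2 := by positivity
    rw [hδ, hD, abs_le]
    constructor <;> linarith
  have hsq : |(D + δ) ^ 2 - D ^ 2| ≤ 2 * x * D ^ 2 := by
    have h3 : |2 * D + δ| ≤ 2 * D + x * D / 2 := by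
      refine (abs_add_le _ _).trans ?_
      rw [abs_of_pos (by linarith : 0 < 2 * D)]
      linarith
    calc |(D + δ) ^ 2 - D ^ 2| = |δ| * |2 * D + δ| := by rw [← abs_mul]; congr 1; ring
      _ ≤ (x * D / 2) * (2 * D + x * D / 2) := by gcongr
      _ = x * D ^ 2 + x * x * (D ^ 2 / 4) := by ring
      _ ≤ x * D ^ 2 + x * 1 * (D ^ 2 / 4) := by gcongr
      _ ≤ 2 * x * D ^ 2 := by nlinarith [mul_nonneg hx0 (sq_nonneg D)]
  have p1 : 0 ≤ x * T1 ^ 3 := by positivity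
  have p2 : 0 ≤ x * T2 ^ 3 := by positivity
  have q1 : 0 ≤ 3 / 4 * T1 * τ1 ^ 2 := by positivity
  have q2 : 0 ≤ 3 / 4 * T2 * τ2 ^ 2 := by positivity
  have hs1 := mul_le_mul_of_nonneg_left (abs_le.1 hsq).1 hK0
  have hs2 := mul_le_mul_of_nonneg_left (abs_le.1 hsq).2 hK0
  rw [abs_le]
  constructor <;> linarith

theorem le_inv_mul_of_le {L₀ L : ℕ} (h0 : 1 ≤ L₀) (h : L₀ ≤ L) {τ : ℝ} (hτ : 0 ≤ τ) :
    τ ≤ 1 / (L₀ : ℝ) * (L * τ) := by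
  have h0' : (0 : ℝ) < L₀ := by exact_mod_cast h0
  have h' : (L₀ : ℝ) ≤ L := by exact_mod_cast h
  rw [one_div_mul_eq_div, le_div_iff₀ h0', mul_comm]
  gcongr

theorem theorem2 {Ω : Type*} [MeasurableSpace Ω] (Q : Measure Ω) [IsProbabilityMeasure Q]
    (x : Ω → ℝ → Bool) (hx : Measurable (Function.uncurry x)) :
    -- PSK, one signal part
    (∀ (N0 PS T0 ν : ℝ), 0 < N0 → 0 < PS → 0 < T0 →
      IsDopplerMCRB Q N0 (pskAmplitude PS (onePart T0) x) ν (sigmaSqMCRB N0 PS (CTone T0))) ∧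
    -- PSK, two signal parts
    (∀ (N0 PS T1 T2 Tpause ν : ℝ),
      0 < N0 → 0 < PS → 0 < T1 → 0 < T2 → 0 ≤ Tpause →
      IsDopplerMCRB Q N0 (pskAmplitude PS (twoParts T1 T2 Tpause) x) ν
        (sigmaSqMCRB N0 PS (CTtwo T1 T2 Tpause))) ∧
    -- ASK, one signal part of `L` symbols of length `T`: exact value
    (∀ (L : ℕ) (N0 PS T ν : ℝ), 1 ≤ L → 0 < N0 → 0 < PS → 0 < T →
      IsDopplerMCRB (Measure.dirac ()) N0 (askAmplitude PS (reflectTimes 0 T L)) ν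
        (sigmaSqMCRB N0 PS (CTone (L * T)) * (1 - 3 / (4 * (L : ℝ) ^ 2))⁻¹)) ∧
    -- ASK, one signal part: approximation for large `L`, uniform in all other parameters
    (∀ ε : ℝ, 0 < ε → ∃ L₀ : ℕ, 1 ≤ L₀ ∧ ∀ (L : ℕ) (N0 PS T ν : ℝ),
      L₀ ≤ L → 0 < N0 → 0 < PS → 0 < T →
      ∃ σ2 : ℝ,
        IsDopplerMCRB (Measure.dirac ()) N0 (askAmplitude PS (reflectTimes 0 T L)) ν σ2 ∧
        |σ2 - sigmaSqMCRB N0 PS (CTone (L * T))| ≤ ε * sigmaSqMCRB N0 PS (CTone (L * T))) ∧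
    -- ASK, two signal parts of `L1` and `L2` symbols of lengths `τ1` and `τ2`: approximation for
    -- large `L1` and `L2`, uniform in all other parameters
    (∀ ε : ℝ, 0 < ε → ∃ L₀ : ℕ, 1 ≤ L₀ ∧ ∀ (L1 L2 : ℕ) (N0 PS τ1 τ2 T1 T2 Tpause ν : ℝ),
      L₀ ≤ L1 → L₀ ≤ L2 → 0 < N0 → 0 < PS → 0 < τ1 → 0 < τ2 → 0 ≤ Tpause →
      T1 = L1 * τ1 → T2 = L2 * τ2 →
      ∃ σ2 : ℝ,
        IsDopplerMCRB (Measure.dirac ()) N0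
          (askAmplitude PS (reflectTimes 0 τ1 L1 ∪ reflectTimes (T1 + Tpause) τ2 L2)) ν σ2 ∧
        |σ2 - sigmaSqMCRB N0 PS (CTtwo T1 T2 Tpause)|
          ≤ ε * sigmaSqMCRB N0 PS (CTtwo T1 T2 Tpause)) := by
  refine ⟨fun N0 PS T0 ν hN hPS hT => isDopplerMCRB_psk_onePart Q hx ν hN hPS hT,
    fun N0 PS T1 T2 Tp ν hN hPS hT1 hT2 hTp =>
      isDopplerMCRB_psk_twoParts Q hx ν hN hPS hT1 hT2 hTp, ?_, ?_, ?_⟩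
  · intro L N0 PS T ν hL hN hPS hT
    have hL' : (L : ℝ) ≠ 0 := by positivity
    -- The exact inertia is `CTone (L * T)` times `1 - 3 / (4 * L ^ 2)`, and this factor is inverted
    -- in the bound.
    have e : sigmaSqMCRB N0 PS (CTone (L * T)) * (1 - 3 / (4 * (L : ℝ) ^ 2))⁻¹ =
        sigmaSqMCRB N0 PS ((L * T) ^ 3 - 3 / 4 * (L * T) * T ^ 2) := by
      have : (L * T) ^ 3 - 3 / 4 * (L * T) * T ^ 2 = CTone (L * T) * (1 - 3 / (4 * (L : ℝ) ^ 2)) := by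
        unfold CTone; field_simp
      rw [this]
      simp only [sigmaSqMCRB, div_eq_mul_inv, mul_inv]
      ring
    rw [e]
    exact isDopplerMCRB_ask_onePart L ν hL hN hPS hT
  · intro ε hε
    obtain ⟨L₀, hL₀, hhalf, hL₀ε⟩ := exists_nat_two_div_le hε
    refine ⟨L₀, hL₀, fun L N0 PS T ν hL hN hPS hT =>
      ⟨_, isDopplerMCRB_ask_onePart L ν (hL₀.trans hL) hN hPS hT, ?_⟩⟩
    have hLpos : (0 : ℝ) < L := by exact_mod_cast hL₀.trans hL
    have hC : 0 < CTone (L * T) := pow_pos (by positivity) 3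
    have hσ : 0 ≤ sigmaSqMCRB N0 PS (CTone (L * T)) := by unfold sigmaSqMCRB; positivity
    refine (abs_sigmaSqMCRB_sub_le hN hPS hC hhalf ?_).trans
      (mul_le_mul_of_nonneg_right hL₀ε hσ)
    have hx0 : 0 ≤ 1 / (L₀ : ℝ) := by positivity
    have herr := symbol_moment_error hT.le (by positivity : 0 ≤ L * T)
      (by rw [show 2 / (L₀ : ℝ) = 2 * (1 / L₀) by ring] at hhalf; linarith)
      (le_inv_mul_of_le hL₀ hL hT.le) hx0
    have hp : 0 ≤ 1 / (L₀ : ℝ) * (L * T) ^ 3 := by positivity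
    have hq : 0 ≤ 3 / 4 * (L * T) * T ^ 2 := by positivity
    -- The relative error here is at most `1 / L₀`; the factor 2 is slack from the threshold shared
    -- with the case of two parts.
    rw [show 2 / (L₀ : ℝ) = 2 * (1 / L₀) by ring, CTone, abs_le]
    constructor <;> linarith
  · intro ε hε
    obtain ⟨L₀, hL₀, hhalf, hL₀ε⟩ := exists_nat_two_div_le hε
    refine ⟨L₀, hL₀, ?_⟩
    rintro L1 L2 N0 PS τ1 τ2 T1 T2 Tp ν hL1 hL2 hN hPS hτ1 hτ2 hTp rfl rfl
    refine ⟨_, isDopplerMCRB_ask_twoParts L1 L2 ν (hL₀.trans hL1) (hL₀.trans hL2) hN hPS hτ1 hτ2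
      hTp, ?_⟩
    have hp1 : (0 : ℝ) < L1 := by exact_mod_cast hL₀.trans hL1
    have hp2 : (0 : ℝ) < L2 := by exact_mod_cast hL₀.trans hL2
    have hC : 0 < CTtwo (L1 * τ1) (L2 * τ2) Tp := by unfold CTtwo; positivity
    have hσ : 0 ≤ sigmaSqMCRB N0 PS (CTtwo (L1 * τ1) (L2 * τ2) Tp) := by
      unfold sigmaSqMCRB; positivity
    refine (abs_sigmaSqMCRB_sub_le hN hPS hC hhalf ?_).trans
      (mul_le_mul_of_nonneg_right hL₀ε hσ)
    rw [show 2 / (L₀ : ℝ) = 2 * (1 / L₀) by ring] at hhalf ⊢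
    exact abs_ask_twoParts_sub_CTtwo_le (by positivity) (by positivity) hTp hτ1.le hτ2.le
      (by positivity) (by linarith) (le_inv_mul_of_le hL₀ hL1 hτ1.le)
      (le_inv_mul_of_le hL₀ hL2 hτ2.le)
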